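/- Let $w=(w_k)_{k\in\mathbb Z}$ be complex numbers with $\overline{w_{-k}}=w_k$ for all $k$ and $|w_k|<C/|k|^3$ for all $k\ne 0$, where $C$ is a constant, and let $v=(v_n)_{n\in\mathbb Z}$ be a bounded real sequence. Let $H$ be the bounded self-adjoint operator on $\ell^2(\mathbb Z)$ given by $$(Hu)_n=\sum_{k\in\mathbb Z}w_k u_{n+k}+v_nu_n ,\qquad n\in\mathbb Z .$$ For $\phi\in\ell^2(\mathbb Z)$ let $\mu_\phi$ be its spectral measure, that is, the Borel measure on $\mathbb R$ with $\int f\,d\mu_\phi=\langle\phi,f(H)\phi\rangle$ for every $f\in C_c(\mathbb R)$, and for $\alpha,E\in\mathbb R$ define the upper $\alpha$-derivative $$D^{+,\alpha}_{\mu_\phi}(E)=\limsup_{\varepsilon\to0^+}\frac{\mu_\phi\big((E-\varepsilon,E+\varepsilon)\big)}{(2\varepsilon)^\alpha}\in[0,\infty].$$ **Theorem.** Let $\alpha,E\in\mathbb R$, and let $u=(u_n)_{n\in\mathbb Z}$ be a complex sequence, $u\neq0$, such that $\sum_{n\in\mathbb Z}(1+|n|)^{-2s}|u_n|^2<\infty$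 for some real $s<1$ (every bounded sequence has this property) and $\sum_{k}w_ku_{n+k}+v_nu_n=E\,u_n$ for all $n\in\mathbb Z$. If $$\liminf_{R\to\infty}R^{-\alpha}\sum_{|n|\le R}|u_n|^2<\infty ,$$ then $D^{+,\alpha}_{\mu_\phi}(E)>0$ for every finitely supported $\phi$ with $\sum_n\overline{\phi_n}\,u_n\neq0$. -/

import Mathlib

open Filter Topology MeasureTheory
open scoped ENNReal ComplexConjugate CompactlySupported lp

noncomputable section

/-- The Hilbert space `ℓ²(ℤ)` of square summable complex sequences. -/
abbrev EllTwo : Type := lp (fun _ : ℤ => ℂ) 2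

/-- The long-range expression `(H u)_n = ∑_k w_k u_{n+k} + v_n u_n` on arbitrary sequences. -/
def longRange (w : ℤ → ℂ) (v : ℤ → ℝ) (u : ℤ → ℂ) (n : ℤ) : ℂ :=
  (∑' k : ℤ, w k * u (n + k)) + (v n : ℂ) * u n

namespace EllTwo

theorem toReal_two_pos : 0 < (2 : ℝ≥0∞).toReal := by norm_num

/-- The shiftBy `n ↦ f (n + k)`, as an element of `ℓ²(ℤ)`. -/
def shiftBy (k : ℤ) (f : EllTwo) : EllTwo :=
  ⟨fun n => f (n + k), by
    refine memℓp_gen ?_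
    exact (Equiv.addRight k).summable_iff.mpr ((lp.memℓp f).summable toReal_two_pos)⟩

@[simp] theorem shiftBy_apply (k : ℤ) (f : EllTwo) (n : ℤ) : shiftBy k f n = f (n + k) := rfl

theorem norm_shiftBy (k : ℤ) (f : EllTwo) : ‖shiftBy k f‖ = ‖f‖ := by
  rw [lp.norm_eq_tsum_rpow toReal_two_pos, lp.norm_eq_tsum_rpow toReal_two_pos]
  congr 1
  exact (Equiv.addRight k).tsum_eq (fun n => ‖f n‖ ^ (2 : ℝ≥0∞).toReal)

theorem summable_smul_shiftBy {w : ℤ → ℂ} (hw : Summable fun k => ‖w k‖) (f : EllTwo) :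
    Summable fun k => ‖w k • shiftBy k f‖ := by
  refine (hw.mul_right ‖f‖).congr fun k => ?_
  rw [norm_smul, norm_shiftBy]

theorem hasSum_mul_shiftBy {w : ℤ → ℂ} (hw : Summable fun k => ‖w k‖) (f : EllTwo) (n : ℤ) :
    HasSum (fun k => w k * f (n + k)) ((∑' k, w k • shiftBy k f : EllTwo) n) := by
  have h := (summable_smul_shiftBy hw f).of_norm.hasSum
  have h2 := (lp.evalCLM ℂ (fun _ : ℤ => ℂ) 2 n).hasSum h
  exact h2

theorem potential_bound {v : ℤ → ℝ} (hv : BddAbove (Set.range fun n => |v n|)) (f : EllTwo)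
    (n : ℤ) : ‖(v n : ℂ) * f n‖ ≤ ‖(((⨆ m, |v m| : ℝ) : ℂ) • f) n‖ := by
  have h : |v n| ≤ ⨆ m, |v m| := le_ciSup hv n
  have h0 : 0 ≤ ⨆ m, |v m| := (abs_nonneg _).trans h
  rw [lp.coeFn_smul, Pi.smul_apply, smul_eq_mul, norm_mul, norm_mul, Complex.norm_real,
    Complex.norm_real, Real.norm_eq_abs, Real.norm_eq_abs, abs_of_nonneg h0]
  gcongr

/-- Multiplication by a bounded real potential, as a map of `ℓ²(ℤ)`. -/
def mulPotential (v : ℤ → ℝ) (hv : BddAbove (Set.range fun n => |v n|)) (f : EllTwo) : EllTwo :=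
  ⟨fun n => (v n : ℂ) * f n,
    (lp.memℓp (((⨆ m, |v m| : ℝ) : ℂ) • f)).mono' (potential_bound hv f)⟩

theorem norm_mulPotential_le {v : ℤ → ℝ} (hv : BddAbove (Set.range fun n => |v n|)) (f : EllTwo) :
    ‖mulPotential v hv f‖ ≤ (⨆ m, |v m|) * ‖f‖ := by
  have h0 : 0 ≤ ⨆ m, |v m| := (abs_nonneg _).trans (le_ciSup hv 0)
  have h := lp.norm_mono (p := 2) (by norm_num) (x := mulPotential v hv f)
    (y := ((⨆ m, |v m| : ℝ) : ℂ) • f) (potential_bound hv f)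
  rwa [norm_smul, Complex.norm_real, Real.norm_eq_abs, abs_of_nonneg h0] at h

theorem longRange_eq {w : ℤ → ℂ} {v : ℤ → ℝ} (hw : Summable fun k => ‖w k‖)
    (hv : BddAbove (Set.range fun n => |v n|)) (f : EllTwo) :
    longRange w v f = ((∑' k, w k • shiftBy k f) + mulPotential v hv f : EllTwo) := by
  funext n
  rw [lp.coeFn_add, Pi.add_apply, longRange, (hasSum_mul_shiftBy hw f n).tsum_eq]
  rfl

theorem summable_mul_apply {w : ℤ → ℂ} (hw : Summable fun k => ‖w k‖) (f : EllTwo) (n : ℤ) :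
    Summable fun k => w k * f (n + k) :=
  (hasSum_mul_shiftBy hw f n).summable

end EllTwo

open EllTwo in
/-- The bounded operator on `ℓ²(ℤ)` given by the long-range expression. -/
def longRangeOp (w : ℤ → ℂ) (v : ℤ → ℝ) (hw : Summable fun k => ‖w k‖)
    (hv : BddAbove (Set.range fun n => |v n|)) : EllTwo →L[ℂ] EllTwo :=
  LinearMap.mkContinuous
    { toFun := fun f => ⟨longRange w v f, by rw [longRange_eq hw hv]; exact lp.memℓp _⟩
      map_add' := fun f g => by
        ext n
        simp only [longRange, lp.coeFn_add, Pi.add_apply, mul_add]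
        rw [(summable_mul_apply hw f n).tsum_add (summable_mul_apply hw g n)]
        ring
      map_smul' := fun c f => by
        ext n
        simp only [longRange, lp.coeFn_smul, Pi.smul_apply, smul_eq_mul, RingHom.id_apply,
          mul_left_comm _ c]
        rw [tsum_mul_left]
        ring }
    ((∑' k, ‖w k‖) + ⨆ m, |v m|) fun f => by
      have h : (⟨longRange w v f, by rw [longRange_eq hw hv]; exact lp.memℓp _⟩ : EllTwo)
          = (∑' k, w k • shiftBy k f) + mulPotential v hv f :=
        lp.ext (longRange_eq hw hv f)
      change ‖(⟨longRange w v f, _⟩ : EllTwo)‖ ≤ _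
      rw [h, add_mul]
      refine (norm_add_le _ _).trans (add_le_add ?_ (norm_mulPotential_le hv f))
      refine (norm_tsum_le_tsum_norm (summable_smul_shiftBy hw f)).trans (le_of_eq ?_)
      rw [← tsum_mul_right]
      exact tsum_congr fun k => by rw [norm_smul, norm_shiftBy]

theorem longRangeOp_apply {w : ℤ → ℂ} {v : ℤ → ℝ} (hw : Summable fun k => ‖w k‖)
    (hv : BddAbove (Set.range fun n => |v n|)) (f : EllTwo) (n : ℤ) :
    longRangeOp w v hw hv f n = (∑' k : ℤ, w k * f (n + k)) + (v n : ℂ) * f n := rfl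

open EllTwo in
theorem isSelfAdjoint_longRangeOp {w : ℤ → ℂ} {v : ℤ → ℝ} (hw : Summable fun k => ‖w k‖)
    (hv : BddAbove (Set.range fun n => |v n|)) (hsymm : ∀ k, conj (w (-k)) = w k) :
    IsSelfAdjoint (longRangeOp w v hw hv) := by
  have key : ∀ f : EllTwo, longRangeOp w v hw hv f
      = (∑' k, w k • shiftBy k f) + mulPotential v hv f :=
    fun f => lp.ext (longRange_eq hw hv f)
  rw [ContinuousLinearMap.isSelfAdjoint_iff_isSymmetric]
  intro f g
  simp only [ContinuousLinearMap.coe_coe]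
  rw [key, key, inner_add_left, inner_add_right]
  congr 1
  · have h1 := (innerSL ℂ f).hasSum (summable_smul_shiftBy hw g).of_norm.hasSum
    have h2 := (innerSLFlip ℂ g).hasSum (summable_smul_shiftBy hw f).of_norm.hasSum
    have e : ∀ k, inner ℂ f (w k • shiftBy k g)
        = inner ℂ (w (-k) • shiftBy (-k) f) g := by
      intro k
      rw [inner_smul_left, inner_smul_right, hsymm, lp.inner_eq_tsum, lp.inner_eq_tsum]
      congr 1
      rw [← (Equiv.addRight k).tsum_eq (fun n => inner ℂ (shiftBy (-k) f n) (g n))]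
      refine tsum_congr fun n => ?_
      simp
    have h2' := (Equiv.neg ℤ).hasSum_iff.mpr h2
    rw [innerSLFlip_apply_apply] at h2'
    refine HasSum.unique ?_ h1
    convert h2' using 1
    funext k
    simpa [mul_comm] using e k
  · rw [lp.inner_eq_tsum, lp.inner_eq_tsum]
    refine tsum_congr fun n => ?_
    change inner ℂ ((v n : ℂ) * f n) (g n) = inner ℂ (f n) ((v n : ℂ) * g n)
    simp [mul_left_comm, mul_assoc]

/-- The positive linear functional `f ↦ ⟨φ, f(T) φ⟩` on compactly supported continuous functions
of a self-adjoint operator `T`. -/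
def spectralFunctional {𝓗 : Type*} [NormedAddCommGroup 𝓗] [InnerProductSpace ℂ 𝓗]
    [CompleteSpace 𝓗] (T : 𝓗 →L[ℂ] 𝓗) (φ : 𝓗) : C_c(ℝ, ℝ) →ₚ[ℝ] ℝ :=
  PositiveLinearMap.mk₀
    { toFun := fun f => (inner ℂ φ (cfc (f : ℝ → ℝ) T φ)).re
      map_add' := fun f g => by
        have h : cfc (⇑(f + g) : ℝ → ℝ) T = cfc (f : ℝ → ℝ) T + cfc (g : ℝ → ℝ) T :=
          cfc_add T (f : ℝ → ℝ) g f.continuous.continuousOn g.continuous.continuousOn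
        rw [h, add_apply, inner_add_right, Complex.add_re]
      map_smul' := fun c f => by
        have h : cfc (⇑(c • f) : ℝ → ℝ) T = c • cfc (f : ℝ → ℝ) T :=
          cfc_smul c (f : ℝ → ℝ) T f.continuous.continuousOn
        rw [h, smul_apply, inner_smul_right_eq_smul, Complex.smul_re]
        rfl }
    fun f hf => by
      have h : (0 : 𝓗 →L[ℂ] 𝓗) ≤ cfc (f : ℝ → ℝ) T := cfc_nonneg fun x _ => hf x
      exact ((ContinuousLinearMap.nonneg_iff_isPositive _).mp h).re_inner_nonneg_right φ

/-- The spectral measure `μ_φ` of the bounded self-adjoint operator `T` at the vector `φ`: the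
measure on `ℝ` that represents the functional `f ↦ ⟨φ, f(T) φ⟩`. -/
def spectralMeasure {𝓗 : Type*} [NormedAddCommGroup 𝓗] [InnerProductSpace ℂ 𝓗]
    [CompleteSpace 𝓗] (T : 𝓗 →L[ℂ] 𝓗) (_hT : IsSelfAdjoint T) (φ : 𝓗) : Measure ℝ :=
  RealRMK.rieszMeasure (spectralFunctional T φ)

/-- The upper `α`-derivative
`limsup_{ε → 0+} μ(E - ε, E + ε) / (2 ε) ^ α`, with values in `[0, ∞]`. -/
def upperDerivative (μ : Measure ℝ) (α E : ℝ) : ℝ≥0∞ :=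
  limsup (fun ε : ℝ => μ (Set.Ioo (E - ε) (E + ε)) / ENNReal.ofReal ((2 * ε) ^ α)) (𝓝[>] 0)

theorem summable_of_cubic_decay {w : ℤ → ℂ} {C : ℝ}
    (h : ∀ k : ℤ, k ≠ 0 → ‖w k‖ < C / |(k : ℝ)| ^ 3) : Summable fun k => ‖w k‖ := by
  have h1 : Summable fun k : ℤ => C * (1 / |(k : ℝ)| ^ 3) := by
    refine Summable.mul_left C ?_
    have := (Real.summable_one_div_int_pow (p := 3)).mpr (by norm_num)
    refine this.abs.congr fun k => ?_
    simp [abs_inv, abs_pow]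
  refine h1.of_norm_bounded_eventually ?_
  refine (Set.finite_singleton (0 : ℤ)).subset fun k hk => ?_
  by_contra h0
  refine hk ?_
  change ‖‖w k‖‖ ≤ C * (1 / |(k : ℝ)| ^ 3)
  rw [norm_norm, mul_one_div]
  exact (h k h0).le

end

noncomputable section

/-! The generalized eigenfunction, cut off at scale `R`, is an approximate eigenvector with error of
order `1 / R`, so it probes the spectral measure at scale `ε = 1 / R` around `E`.

With `p(x) = ε² / ((x - E)² + ε²)` and `q(x) = (x - E) / ((x - E)² + ε²)` one has `1 = p(H) + q(H)
(H - E)`. Apply this to a cutoff `χ u` and pair with `φ`. If `F(ε) = ⟨φ, p(H) φ⟩`, both `p²` and `(ε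
q)²` are at most `p`, hence `|⟨φ, χ u⟩| ≤ √F(ε) (‖χ u‖ + ‖(H - E) χ u‖ / ε)`
(`norm_inner_le_sqrt_poissonForm`).

The commutator estimate `exists_norm_commutator_le` gives `‖(H - E) χ u‖ ≤ (A / R) (‖u‖_R + 1)`,
where `‖u‖_R` is the norm of `u` on `|n| ≤ R`. Since `⟨φ, χ u⟩` tends to a nonzero limit, `F(1 / R)
‖u‖_R² ≥ c > 0` for large `R`.

If the upper derivative vanished, a dyadic decomposition would give `F(ε) = o(ε ^ γ)` for every `γ ≤
α` with `γ < 2`. As `‖u‖_R² ≤ K R ^ γ` for arbitrarily large `R` and some such `γ`, this contradicts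
the lower bound. -/

/-- The Poisson-type weight `ε² / ((x - E)² + ε²)`. -/
def poissonWeight (E ε x : ℝ) : ℝ := ε ^ 2 / ((x - E) ^ 2 + ε ^ 2)

theorem poissonWeight_nonneg (E ε x : ℝ) : 0 ≤ poissonWeight E ε x := by
  unfold poissonWeight; positivity

theorem continuous_poissonWeight (E : ℝ) {ε : ℝ} (hε : 0 < ε) :
    Continuous (poissonWeight E ε) := by
  unfold poissonWeight
  exact Continuous.div (by fun_prop) (by fun_prop) fun x => by positivity

theorem continuous_conjPoisson (E : ℝ) {ε : ℝ} (hε : 0 < ε) :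
    Continuous fun x : ℝ => (x - E) / ((x - E) ^ 2 + ε ^ 2) :=
  Continuous.div (by fun_prop) (by fun_prop) fun x => by positivity

/-! ### Functional calculus and Poisson integrals of the spectral measure. -/

section Hilbert

variable {𝓗 : Type*} [NormedAddCommGroup 𝓗] [InnerProductSpace ℂ 𝓗] [CompleteSpace 𝓗]

theorem re_inner_cfc_mono {T : 𝓗 →L[ℂ] 𝓗} {f g : ℝ → ℝ} (hf : Continuous f)
    (hg : Continuous g) (hfg : ∀ x, f x ≤ g x) (φ : 𝓗) :
    (inner ℂ φ (cfc f T φ)).re ≤ (inner ℂ φ (cfc g T φ)).re := by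
  have h : cfc f T ≤ cfc g T :=
    cfc_mono (fun x _ => hfg x) hf.continuousOn hg.continuousOn
  have h2 := ((ContinuousLinearMap.nonneg_iff_isPositive _).mp
    (sub_nonneg.mpr h)).re_inner_nonneg_right φ
  rw [sub_apply, inner_sub_right, map_sub] at h2
  exact sub_nonneg.mp h2

theorem inner_cfc_comm (T : 𝓗 →L[ℂ] 𝓗) (f : ℝ → ℝ) (x y : 𝓗) :
    inner ℂ x (cfc f T y) = inner ℂ (cfc f T x) y := by
  have h : IsSelfAdjoint (cfc f T) := cfc_predicate f T
  exact ((ContinuousLinearMap.isSelfAdjoint_iff_isSymmetric.mp h) x y).symm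

theorem norm_cfc_apply_sq (T : 𝓗 →L[ℂ] 𝓗) {f : ℝ → ℝ} (hf : Continuous f) (φ : 𝓗) :
    ‖cfc f T φ‖ ^ 2 = (inner ℂ φ (cfc (fun x => f x * f x) T φ)).re := by
  rw [cfc_mul f f T hf.continuousOn hf.continuousOn]
  change _ = (inner ℂ φ (cfc f T (cfc f T φ))).re
  rw [inner_cfc_comm]
  exact norm_sq_eq_re_inner (𝕜 := ℂ) _

/-- The Poisson integral `⟨φ, ε² ((T - E)² + ε²)⁻¹ φ⟩` of the spectral measure at `φ`. -/
def poissonForm (T : 𝓗 →L[ℂ] 𝓗) (φ : 𝓗) (E ε : ℝ) : ℝ :=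
  (inner ℂ φ (cfc (poissonWeight E ε) T φ)).re

theorem poissonForm_nonneg (T : 𝓗 →L[ℂ] 𝓗) (φ : 𝓗) (E : ℝ) {ε : ℝ} (hε : 0 < ε) :
    0 ≤ poissonForm T φ E ε := by
  have := re_inner_cfc_mono (T := T) (f := fun _ => 0) continuous_const
    (continuous_poissonWeight E hε) (poissonWeight_nonneg E _) φ
  simpa [poissonForm] using this

/-- Split `x = p(T) x + q(T) (T - E) x`, move `p(T)` and `q(T)` onto `φ`, and use Cauchy-Schwarz. In
the application `x` is a cut-off eigenfunction and `ε = 1 / R`, which balances the two terms. -/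
theorem norm_inner_le_sqrt_poissonForm {T : 𝓗 →L[ℂ] 𝓗} (hT : IsSelfAdjoint T) (E : ℝ) {ε : ℝ}
    (hε : 0 < ε) (φ x : 𝓗) :
    ‖inner ℂ φ x‖ ≤ √(poissonForm T φ E ε) * (‖x‖ + ‖T x - (E : ℂ) • x‖ / ε) := by
  set q : ℝ → ℝ := fun x => (x - E) / ((x - E) ^ 2 + ε ^ 2) with hq
  have hqc : Continuous q := continuous_conjPoisson E hε
  have hpc := continuous_poissonWeight E hε
  unfold poissonForm
  set F := (inner ℂ φ (cfc (poissonWeight E ε) T φ)).re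
  have h1 : ‖cfc (poissonWeight E ε) T φ‖ ≤ √F := by
    apply Real.le_sqrt_of_sq_le
    rw [norm_cfc_apply_sq T hpc]
    refine re_inner_cfc_mono (hpc.mul hpc) hpc (fun x => ?_) φ
    refine mul_le_of_le_one_left (poissonWeight_nonneg E ε x) ?_
    unfold poissonWeight
    rw [div_le_one (by positivity)]
    nlinarith [sq_nonneg (x - E)]
  have h2 : ‖cfc q T φ‖ ≤ √F / ε := by
    rw [le_div_iff₀ hε]
    apply Real.le_sqrt_of_sq_le
    have h3 : ‖cfc (fun x => ε * q x) T φ‖ ^ 2 ≤ F := by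
      rw [norm_cfc_apply_sq T (hqc.const_mul ε)]
      refine re_inner_cfc_mono (by fun_prop) hpc (fun x => ?_) φ
      have : 0 < (x - E) ^ 2 + ε ^ 2 := by positivity
      simp only [hq, poissonWeight]
      rw [mul_div_assoc', div_mul_div_comm, div_le_div_iff₀ (by positivity) this]
      nlinarith [mul_nonneg (mul_nonneg (sq_nonneg ε) (sq_nonneg ε)) this.le]
    rw [cfc_const_mul ε q T hqc.continuousOn, smul_apply, norm_smul, Real.norm_of_nonneg hε.le]
      at h3
    linarith [mul_comm ε ‖cfc q T φ‖]
  have h4 : x = cfc (poissonWeight E ε) T x + cfc q T (T x - (E : ℂ) • x) := by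
    have e1 : cfc (fun t : ℝ => t - E) T = T - (E : ℂ) • 1 := by
      rw [cfc_sub (fun t => t) (fun _ => E) T, cfc_id' ℝ T, cfc_const E T]
      rfl
    have e2 : cfc (poissonWeight E ε) T + cfc q T * (T - (E : ℂ) • 1) = 1 := by
      rw [← e1, ← cfc_mul q _ T hqc.continuousOn (by fun_prop),
        ← cfc_add T _ _ hpc.continuousOn (by fun_prop), ← cfc_one ℝ T]
      congr 1
      funext t
      have : (t - E) ^ 2 + ε ^ 2 ≠ 0 := by positivity
      simp only [hq, poissonWeight, Pi.one_apply]
      field_simp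
      ring
    have := congrArg (fun S : 𝓗 →L[ℂ] 𝓗 => S x) e2
    simpa using this.symm
  have h5 : inner ℂ φ x = inner ℂ (cfc (poissonWeight E ε) T φ) x
      + inner ℂ (cfc q T φ) (T x - (E : ℂ) • x) := by
    conv_lhs => rw [h4]
    rw [inner_add_right, inner_cfc_comm, inner_cfc_comm]
  rw [h5]
  refine (norm_add_le _ _).trans ?_
  have h6 := (norm_inner_le_norm (𝕜 := ℂ) (cfc (poissonWeight E ε) T φ) x).trans
    (mul_le_mul_of_nonneg_right h1 (norm_nonneg _))
  have h7 := (norm_inner_le_norm (𝕜 := ℂ) (cfc q T φ) (T x - (E : ℂ) • x)).trans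
    (mul_le_mul_of_nonneg_right h2 (norm_nonneg _))
  calc _ ≤ _ := add_le_add h6 h7
    _ = _ := by ring

/-- Spectral integrals are dominated by integrals over a fixed set of finite measure. -/
theorem exists_finite_re_inner_cfc_le {T : 𝓗 →L[ℂ] 𝓗} (hT : IsSelfAdjoint T) (φ : 𝓗) :
    ∃ K : Set ℝ, IsFiniteMeasure ((spectralMeasure T hT φ).restrict K) ∧
      ∀ f : ℝ → ℝ, Continuous f → (∀ x, 0 ≤ f x) →
      ENNReal.ofReal (inner ℂ φ (cfc f T φ)).re
        ≤ ∫⁻ x in K, ENNReal.ofReal (f x) ∂(spectralMeasure T hT φ) := by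
  -- The measure represents the functional only on compactly supported functions, which the Poisson
  -- weight is not. Multiplying by a bump `η` equal to `1` on the spectrum leaves `cfc f T`
  -- unchanged, and `tsupport η` serves as `K`.
  obtain ⟨η, hη1, -, hηc, hη01⟩ := exists_continuous_one_zero_of_isCompact
    (spectrum.isCompact (𝕜 := ℝ) T) (isClosed_empty) (Set.disjoint_empty _)
  set μ := spectralMeasure T hT φ with hμ
  have : IsFiniteMeasureOnCompacts μ := by
    rw [hμ, spectralMeasure]
    infer_instance
  refine ⟨tsupport η, isFiniteMeasure_restrict.mpr hηc.measure_ne_top, fun f hf hf0 => ?_⟩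
  let g : C_c(ℝ, ℝ) := ⟨⟨fun x => f x * η x, by fun_prop⟩, hηc.mul_left⟩
  have hg : ∀ x, g x = f x * η x := fun _ => rfl
  have e1 : cfc f T = cfc (g : ℝ → ℝ) T := by
    refine cfc_congr fun x hx => ?_
    rw [hg, hη1 hx]; simp
  have e2 : (inner ℂ φ (cfc f T φ)).re = ∫ x, g x ∂μ := by
    rw [e1]
    exact (RealRMK.integral_rieszMeasure (spectralFunctional T φ) g).symm
  have hg0 : ∀ x, 0 ≤ g x := fun x => mul_nonneg (hf0 x) (hη01 x).1
  rw [e2]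
  refine (ENNReal.ofReal_le_ofReal (le_of_eq ?_)).trans (ofReal_integral_eq_lintegral_ofReal
    (μ := μ.restrict (tsupport η)) (f := g) ?_ (ae_of_all _ hg0)).le |>.trans ?_
  · rw [setIntegral_eq_integral_of_forall_compl_eq_zero]
    intro x hx
    rw [hg, image_eq_zero_of_notMem_tsupport hx, mul_zero]
  · exact (g.continuous.integrable_of_hasCompactSupport g.hasCompactSupport).restrict
  · exact lintegral_mono fun x => ENNReal.ofReal_le_ofReal
      (mul_le_of_le_one_right (hf0 x) (hη01 x).2)

end Hilbert

/-! ### From interval masses to Poisson integrals. -/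

/-- One term suffices: if `2 ^ n * ε ≤ |x - E| < 2 ^ (n + 1) * ε`, the weight is at most `4 ^ (-n)`,
which is the coefficient with index `j = n + 1`. -/
theorem ofReal_poissonWeight_le_tsum_indicator (E : ℝ) {ε : ℝ} (hε : 0 < ε) (x : ℝ) :
    ENNReal.ofReal (poissonWeight E ε x) ≤ ∑' j : ℕ,
      (Set.Ioo (E - 2 ^ j * ε) (E + 2 ^ j * ε)).indicator
        (fun _ => ENNReal.ofReal (4 * (1 / 4) ^ j)) x := by
  obtain ⟨j, hj, hjle⟩ : ∃ j : ℕ, |x - E| < 2 ^ j * ε ∧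
      poissonWeight E ε x ≤ 4 * (1 / 4) ^ j := by
    unfold poissonWeight
    have hpos : 0 < (x - E) ^ 2 + ε ^ 2 := by positivity
    rcases lt_or_ge |x - E| ε with h | h
    · refine ⟨0, by simpa using h, ?_⟩
      rw [div_le_iff₀ hpos]
      nlinarith [sq_nonneg (x - E), sq_nonneg ε]
    · obtain ⟨n, hn1, hn2⟩ := exists_nat_pow_near ((one_le_div hε).mpr h) (one_lt_two)
      refine ⟨n + 1, (div_lt_iff₀ hε).mp hn2, ?_⟩
      rw [le_div_iff₀ hε] at hn1
      have h2 : (2 ^ n * ε) ^ 2 ≤ (x - E) ^ 2 := by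
        rw [← sq_abs (x - E)]
        gcongr
      have h3 : (2 ^ n * ε) ^ 2 = 4 ^ n * ε ^ 2 := by
        rw [mul_pow, ← pow_mul, mul_comm n, pow_mul]; norm_num
      rw [pow_succ (1 / 4 : ℝ), one_div, inv_pow, div_le_iff₀ hpos]
      have h4 : (0 : ℝ) < 4 ^ n := by positivity
      rw [show (4 : ℝ) * ((4 ^ n)⁻¹ * 4⁻¹) * ((x - E) ^ 2 + ε ^ 2)
        = ((x - E) ^ 2 + ε ^ 2) / 4 ^ n by field_simp, le_div_iff₀ h4]
      nlinarith [sq_nonneg ε]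
  refine le_trans ?_ (ENNReal.le_tsum j)
  rw [Set.indicator_of_mem]
  · exact ENNReal.ofReal_le_ofReal hjle
  · rw [abs_lt] at hj
    constructor <;> linarith

/-- Summing over dyadic intervals yields geometric series of ratios `2 ^ α / 4` and `2 ^ β / 4`;
this is why the exponents must stay below `2`. -/
theorem lintegral_poissonWeight_le {ν : Measure ℝ} {E A B α β : ℝ} (hA : 0 ≤ A) (hB : 0 ≤ B)
    (hα : α < 2) (hβ : β < 2)
    (h : ∀ r : ℝ, 0 < r →
      ν (Set.Ioo (E - r) (E + r)) ≤ ENNReal.ofReal (A * r ^ α + B * r ^ β))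
    {ε : ℝ} (hε : 0 < ε) :
    ∫⁻ x, ENNReal.ofReal (poissonWeight E ε x) ∂ν ≤
      ENNReal.ofReal (4 * (1 - 2 ^ α / 4)⁻¹ * A * ε ^ α + 4 * (1 - 2 ^ β / 4)⁻¹ * B * ε ^ β) := by
  have hgeom : ∀ γ : ℝ, γ < 2 → HasSum (fun j : ℕ => ((2 : ℝ) ^ γ / 4) ^ j)
      (1 - (2 : ℝ) ^ γ / 4)⁻¹ := by
    intro γ hγ
    refine hasSum_geometric_of_lt_one (by positivity) ?_
    rw [div_lt_one (by norm_num)]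
    calc (2 : ℝ) ^ γ < 2 ^ (2 : ℝ) := Real.rpow_lt_rpow_of_exponent_lt (by norm_num) hγ
      _ = 4 := by norm_num
  have hterm : ∀ (γ : ℝ) (j : ℕ),
      4 * (1 / 4 : ℝ) ^ j * (2 ^ j * ε) ^ γ = 4 * ε ^ γ * ((2 : ℝ) ^ γ / 4) ^ j := by
    intro γ j
    rw [Real.mul_rpow (by positivity) hε.le, ← Real.rpow_natCast_mul (by norm_num),
      mul_comm (j : ℝ) γ, Real.rpow_mul_natCast (by norm_num), div_pow, div_pow, one_pow]
    ring
  have hsum := ((hgeom α hα).mul_left (4 * A * ε ^ α)).add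
    ((hgeom β hβ).mul_left (4 * B * ε ^ β))
  calc ∫⁻ x, ENNReal.ofReal (poissonWeight E ε x) ∂ν
      ≤ ∫⁻ x, ∑' j : ℕ, (Set.Ioo (E - 2 ^ j * ε) (E + 2 ^ j * ε)).indicator
        (fun _ => ENNReal.ofReal (4 * (1 / 4) ^ j)) x ∂ν :=
        lintegral_mono (ofReal_poissonWeight_le_tsum_indicator E hε)
    _ = ∑' j : ℕ, ENNReal.ofReal (4 * (1 / 4) ^ j)
          * ν (Set.Ioo (E - 2 ^ j * ε) (E + 2 ^ j * ε)) := by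
        rw [lintegral_tsum fun j =>
          (measurable_const.indicator measurableSet_Ioo).aemeasurable]
        exact tsum_congr fun j => lintegral_indicator_const measurableSet_Ioo _
    _ ≤ ∑' j : ℕ, ENNReal.ofReal (4 * A * ε ^ α * ((2 : ℝ) ^ α / 4) ^ j
          + 4 * B * ε ^ β * ((2 : ℝ) ^ β / 4) ^ j) := by
        refine ENNReal.tsum_le_tsum fun j => ?_
        refine (mul_le_mul_right (h _ (by positivity)) _).trans (le_of_eq ?_)
        rw [← ENNReal.ofReal_mul (by positivity)]
        congr 1
        linear_combination A * hterm α j + B * hterm β j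
    _ = ENNReal.ofReal (∑' j : ℕ, (4 * A * ε ^ α * ((2 : ℝ) ^ α / 4) ^ j
          + 4 * B * ε ^ β * ((2 : ℝ) ^ β / 4) ^ j)) :=
        (ENNReal.ofReal_tsum_of_nonneg (fun j => by positivity) hsum.summable).symm
    _ = _ := by
        rw [hsum.tsum_eq]
        congr 1
        ring

/-- If `ν(E - ε, E + ε) = o(ε ^ α)` with `α < 2`, then the Poisson integrals are `o(ε ^ α)`. -/
theorem lintegral_poissonWeight_isLittleO {ν : Measure ℝ} [IsFiniteMeasure ν] {E α : ℝ}
    (hα : α < 2)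
    (h : ∀ δ : ℝ, 0 < δ → ∀ᶠ ε in 𝓝[>] (0 : ℝ),
      ν (Set.Ioo (E - ε) (E + ε)) ≤ ENNReal.ofReal (δ * (2 * ε) ^ α))
    {δ : ℝ} (hδ : 0 < δ) :
    ∀ᶠ ε in 𝓝[>] (0 : ℝ),
      ∫⁻ x, ENNReal.ofReal (poissonWeight E ε x) ∂ν ≤ ENNReal.ofReal (δ * ε ^ α) := by
  -- The second power absorbs the total mass at radii `r ≥ ε₀`, where smallness is unknown: `β > 0`
  -- makes `B * r ^ β` dominate there, `β > α` makes it negligible against `ε ^ α`, and `β < 2`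
  -- keeps the series convergent.
  obtain ⟨β, hβ1, hβ2⟩ := exists_between (max_lt hα (zero_lt_two' ℝ))
  obtain ⟨hαβ, hβ0⟩ := max_lt_iff.mp hβ1
  have hα4 : 0 < 1 - (2 : ℝ) ^ α / 4 := by
    have : (2 : ℝ) ^ α < 2 ^ (2 : ℝ) := Real.rpow_lt_rpow_of_exponent_lt (by norm_num) hα
    norm_num at this
    linarith
  have hβ4 : 0 < 1 - (2 : ℝ) ^ β / 4 := by
    have : (2 : ℝ) ^ β < 2 ^ (2 : ℝ) := Real.rpow_lt_rpow_of_exponent_lt (by norm_num) hβ2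
    norm_num at this
    linarith
  -- Chosen so that the small-radius part contributes exactly `δ / 2 * ε ^ α`.
  set a : ℝ := δ * (1 - (2 : ℝ) ^ α / 4) / 8
  have ha : 0 < a := by positivity
  obtain ⟨ε₀, hε₀, hε₀'⟩ := mem_nhdsGT_iff_exists_Ioo_subset.mp
    (h (a / 2 ^ α) (by positivity))
  rw [Set.mem_Ioi] at hε₀
  set B : ℝ := ν.real Set.univ / ε₀ ^ β with hB
  have hB0 : 0 ≤ B := by positivity
  have hbd : ∀ r : ℝ, 0 < r →
      ν (Set.Ioo (E - r) (E + r)) ≤ ENNReal.ofReal (a * r ^ α + B * r ^ β) := by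
    intro r hr
    rcases lt_or_ge r ε₀ with h1 | h1
    · refine (hε₀' ⟨hr, h1⟩).trans (ENNReal.ofReal_le_ofReal ?_)
      rw [Real.mul_rpow (by norm_num) hr.le,
        show a / 2 ^ α * (2 ^ α * r ^ α) = a * r ^ α by field_simp]
      have : 0 ≤ B * r ^ β := by positivity
      linarith
    · refine (measure_mono (Set.subset_univ _)).trans ?_
      rw [← ofReal_measureReal]
      refine ENNReal.ofReal_le_ofReal ?_
      have h2 : ε₀ ^ β ≤ r ^ β := Real.rpow_le_rpow hε₀.le h1 hβ0.le
      have h3 : 0 < ε₀ ^ β := by positivity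
      have h4 : ν.real Set.univ ≤ B * r ^ β := by
        rw [hB, div_mul_eq_mul_div, le_div_iff₀ h3]
        gcongr
      have : 0 ≤ a * r ^ α := by positivity
      linarith
  have hlim : Tendsto (fun ε : ℝ => 4 * (1 - 2 ^ β / 4)⁻¹ * B * ε ^ (β - α)) (𝓝[>] 0) (𝓝 0) := by
    have := ((Real.continuousAt_rpow_const 0 (β - α) (Or.inr (by linarith))).tendsto.mono_left
      (nhdsWithin_le_nhds (s := Set.Ioi 0))).const_mul (4 * (1 - (2 : ℝ) ^ β / 4)⁻¹ * B)
    rwa [Real.zero_rpow (by linarith), mul_zero] at this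
  filter_upwards [hlim.eventually_le_const (half_pos hδ), self_mem_nhdsWithin] with ε h1 hε
  rw [Set.mem_Ioi] at hε
  refine (lintegral_poissonWeight_le ha.le hB0 hα hβ2 hbd hε).trans
    (ENNReal.ofReal_le_ofReal ?_)
  have e1 : 4 * (1 - (2 : ℝ) ^ α / 4)⁻¹ * a = δ / 2 := by
    simp only [a]
    generalize 1 - (2 : ℝ) ^ α / 4 = y at hα4
    field_simp
    norm_num
  have e2 : ε ^ β = ε ^ (β - α) * ε ^ α := by
    rw [← Real.rpow_add hε]; congr 1; ring
  rw [e1, e2, ← mul_assoc]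
  have := mul_le_mul_of_nonneg_right h1 (Real.rpow_nonneg hε.le α)
  linarith

theorem eventually_measure_le_of_upperDerivative_eq_zero {μ : Measure ℝ} {α E : ℝ}
    (h : upperDerivative μ α E = 0) {α' : ℝ} (hα : α' ≤ α) {δ : ℝ} (hδ : 0 < δ) :
    ∀ᶠ ε in 𝓝[>] (0 : ℝ),
      μ (Set.Ioo (E - ε) (E + ε)) ≤ ENNReal.ofReal (δ * (2 * ε) ^ α') := by
  have h1 : upperDerivative μ α E < ENNReal.ofReal δ := by rw [h]; simpa using hδ
  filter_upwards [eventually_lt_of_limsup_lt h1, Ioo_mem_nhdsGT (show (0 : ℝ) < 1 / 2 by norm_num)]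
    with ε h2 hε
  have h3 : 0 < 2 * ε := by linarith [hε.1]
  have h4 : 0 < (2 * ε) ^ α := by positivity
  rw [ENNReal.div_lt_iff (Or.inl (by simpa using h4)) (Or.inl ENNReal.ofReal_ne_top),
    ← ENNReal.ofReal_mul hδ.le] at h2
  refine h2.le.trans (ENNReal.ofReal_le_ofReal ?_)
  gcongr ?_ * ?_
  exact Real.rpow_le_rpow_of_exponent_ge h3 (by linarith [hε.2]) hα

/-! ### Cutoffs and truncations. -/

/-- The cubic tent cutoff `(1 - |n| / R)₊ ^ 3`. -/
def tentCube (R : ℕ) (n : ℤ) : ℝ := (max 0 (1 - |(n : ℝ)| / R)) ^ 3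

theorem tentCube_nonneg (R : ℕ) (n : ℤ) : 0 ≤ tentCube R n := by
  unfold tentCube; positivity

theorem tentCube_le_one (R : ℕ) (n : ℤ) : tentCube R n ≤ 1 := by
  refine pow_le_one₀ (le_max_left _ _) (max_le zero_le_one ?_)
  have : 0 ≤ |(n : ℝ)| / R := by positivity
  linarith

theorem tentCube_eq_zero {R : ℕ} (hR : 0 < R) {n : ℤ} (h : (R : ℝ) ≤ |(n : ℝ)|) :
    tentCube R n = 0 := by
  have : 1 ≤ |(n : ℝ)| / R := (one_le_div (by exact_mod_cast hR)).mpr h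
  rw [tentCube, max_eq_left (by linarith), zero_pow (by norm_num)]

theorem abs_tentCube_sub_le (R : ℕ) (m n : ℤ) :
    |tentCube R m - tentCube R n| ≤ 3 / R * |(m : ℝ) - n| := by
  unfold tentCube
  have h01 : ∀ k : ℤ, max 0 (1 - |(k : ℝ)| / R) ∈ Set.Icc (0 : ℝ) 1 := fun k => by
    refine ⟨le_max_left _ _, max_le zero_le_one ?_⟩
    have : 0 ≤ |(k : ℝ)| / R := by positivity
    linarith
  have hlip : |max 0 (1 - |(m : ℝ)| / R) - max 0 (1 - |(n : ℝ)| / R)| ≤ |(m : ℝ) - n| / R := by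
    refine (abs_max_sub_max_le_max _ _ _ _).trans ?_
    rw [sub_self, abs_zero, max_eq_right (abs_nonneg _), sub_sub_sub_cancel_left, ← sub_div,
      abs_div, Nat.abs_cast, abs_sub_comm (m : ℝ) n]
    refine div_le_div_of_nonneg_right ?_ (Nat.cast_nonneg R)
    exact abs_abs_sub_abs_le (n : ℝ) m
  set a := max 0 (1 - |(m : ℝ)| / R)
  set b := max 0 (1 - |(n : ℝ)| / R)
  obtain ⟨ha0, ha1⟩ := h01 m
  obtain ⟨hb0, hb1⟩ := h01 n
  have h3 : |a ^ 2 + a * b + b ^ 2| ≤ 3 := by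
    rw [abs_of_nonneg (by positivity)]
    nlinarith
  calc |a ^ 3 - b ^ 3| = |a ^ 2 + a * b + b ^ 2| * |a - b| := by
        rw [← abs_mul]; ring_nf
    _ ≤ 3 * (|(m : ℝ) - n| / R) := mul_le_mul h3 hlip (abs_nonneg _) (by norm_num)
    _ = _ := by ring

/-- The cutoff gains the decay in `m` from the off-diagonal decay. -/
theorem tentCube_mul_le {R : ℕ} (hR : 0 < R) {n m : ℤ} (hn : |(n : ℝ)| ≤ R)
    (hm : (R : ℝ) < |(m : ℝ)|) :
    tentCube R n * (1 / |(m : ℝ) - n| ^ 3) ≤ 1 / |(m : ℝ)| ^ 3 := by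
  -- Because `|m| > R`, `|m - n| ≥ |m| - |n| ≥ |m| (1 - |n| / R)`. Cubing shows why the tent is
  -- raised to the power that matches the decay of `w`.
  have hR' : (0 : ℝ) < R := by exact_mod_cast hR
  have h1 : |(m : ℝ)| - |(n : ℝ)| ≤ |(m : ℝ) - n| := abs_sub_abs_le_abs_sub _ _
  have h2 : 0 < |(m : ℝ) - n| := by linarith
  have hm0 : 0 < |(m : ℝ)| := by linarith
  have h0 : 0 ≤ 1 - |(n : ℝ)| / R := by
    rw [sub_nonneg, div_le_one hR']; exact hn
  rw [tentCube, max_eq_right h0, mul_one_div, ← div_pow, ← one_div_pow]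
  refine pow_le_pow_left₀ (by positivity) ?_ 3
  rw [div_le_div_iff₀ h2 hm0, one_mul, one_sub_div hR'.ne', div_mul_eq_mul_div, div_le_iff₀ hR']
  nlinarith [abs_nonneg (n : ℝ), mul_nonneg (abs_nonneg (n : ℝ)) (sub_nonneg.mpr hm.le)]

theorem tendsto_tentCube (n : ℤ) : Tendsto (fun R => tentCube R n) atTop (𝓝 1) := by
  have h : Tendsto (fun R : ℕ => |(n : ℝ)| / R) atTop (𝓝 0) :=
    tendsto_const_div_atTop_nhds_zero_nat _
  have h2 := ((tendsto_const_nhds (x := (0 : ℝ))).max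
    ((tendsto_const_nhds (x := (1 : ℝ))).sub h)).pow 3
  simpa [tentCube] using h2

/-- A finitely supported sequence as an element of `ℓ²(ℤ)`. -/
def EllTwo.ofFinite (f : ℤ → ℂ) (hf : f.support.Finite) : EllTwo :=
  ⟨f, by
    refine memℓp_gen (summable_of_hasFiniteSupport (hf.subset fun n hn h0 => hn ?_))
    simp [h0]⟩

theorem EllTwo.norm_sq_eq_sum {f : EllTwo} {s : Finset ℤ} (hf : ∀ n ∉ s, f n = 0) :
    ‖f‖ ^ 2 = ∑ n ∈ s, ‖f n‖ ^ 2 := by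
  have h := lp.norm_rpow_eq_tsum EllTwo.toReal_two_pos f
  simp only [ENNReal.toReal_ofNat, Real.rpow_ofNat] at h
  rw [h, tsum_eq_sum fun n hn => by rw [hf n hn]; simp]

/-- Truncation of a sequence to `|n| ≤ R`. -/
def truncate (u : ℤ → ℂ) (R : ℕ) : EllTwo :=
  EllTwo.ofFinite ((Finset.Icc (-(R : ℤ)) R : Set ℤ).indicator u)
    ((Finset.finite_toSet _).subset Set.support_indicator_subset)

theorem truncate_apply (u : ℤ → ℂ) (R : ℕ) (n : ℤ) :
    truncate u R n = if |(n : ℝ)| ≤ R then u n else 0 := by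
  change (Finset.Icc (-(R : ℤ)) R : Set ℤ).indicator u n = _
  rw [Set.indicator_apply]
  congr 1
  simp only [Finset.coe_Icc, Set.mem_Icc, abs_le, eq_iff_iff]
  norm_cast

theorem norm_truncate_sq (u : ℤ → ℂ) (R : ℕ) :
    ‖truncate u R‖ ^ 2 = ∑ n ∈ Finset.Icc (-(R : ℤ)) R, ‖u n‖ ^ 2 := by
  have hmem : ∀ n : ℤ, |(n : ℝ)| ≤ R ↔ n ∈ Finset.Icc (-(R : ℤ)) R := fun n => by
    rw [Finset.mem_Icc, abs_le]; norm_cast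
  rw [EllTwo.norm_sq_eq_sum (s := Finset.Icc (-(R : ℤ)) R)]
  · refine Finset.sum_congr rfl fun n hn => ?_
    rw [truncate_apply, if_pos ((hmem n).mpr hn)]
  · intro n hn
    rw [truncate_apply, if_neg (mt (hmem n).mp hn)]

theorem norm_truncate_one (R : ℕ) : ‖truncate 1 R‖ ^ 2 = 2 * R + 1 := by
  rw [norm_truncate_sq]
  simp only [Pi.one_apply, norm_one, one_pow, Finset.sum_const, Int.card_Icc, nsmul_eq_mul,
    mul_one]
  rw [show (R : ℤ) + 1 - -R = ((2 * R + 1 : ℕ) : ℤ) by push_cast; ring, Int.toNat_natCast]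
  push_cast
  rfl

/-- The smoothly cut off sequence `n ↦ (1 - |n| / R)₊ ^ 3 u_n` in `ℓ²(ℤ)`. -/
def tentCut (u : ℤ → ℂ) (R : ℕ) : EllTwo :=
  -- The factor `truncate u R` keeps the support finite also for `R = 0`, where division by zero
  -- makes `tentCube` identically `1`.
  EllTwo.ofFinite (fun n => (tentCube R n : ℂ) * truncate u R n) (by
    refine (Finset.finite_toSet (Finset.Icc (-(R : ℤ)) R)).subset fun n hn => ?_
    refine Set.support_indicator_subset (f := u) ?_
    exact right_ne_zero_of_mul hn)

theorem tentCut_apply (u : ℤ → ℂ) {R : ℕ} (hR : 0 < R) (n : ℤ) :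
    tentCut u R n = (tentCube R n : ℂ) * u n := by
  change (tentCube R n : ℂ) * truncate u R n = _
  rw [truncate_apply]
  split_ifs with h
  · rfl
  · rw [tentCube_eq_zero hR (not_le.mp h).le]; simp

theorem norm_tentCut_le (u : ℤ → ℂ) (R : ℕ) : ‖tentCut u R‖ ≤ ‖truncate u R‖ := by
  refine lp.norm_mono (by norm_num) fun n => ?_
  change ‖(tentCube R n : ℂ) * truncate u R n‖ ≤ _
  rw [norm_mul, Complex.norm_real, Real.norm_of_nonneg (tentCube_nonneg R n)]
  exact mul_le_of_le_one_left (norm_nonneg _) (tentCube_le_one R n)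

theorem tendsto_inner_tentCut {φ : EllTwo} (hφ : (Function.support (φ : ℤ → ℂ)).Finite)
    (u : ℤ → ℂ) :
    Tendsto (fun R => inner ℂ φ (tentCut u R)) atTop
      (𝓝 (∑' n : ℤ, (starRingEnd ℂ) (φ n) * u n)) := by
  have hz : ∀ n ∉ hφ.toFinset, φ n = 0 := fun n hn => by simpa using hn
  rw [tsum_eq_sum (s := hφ.toFinset) fun n hn => by rw [hz n hn]; simp]
  have h1 : Tendsto (fun R : ℕ => ∑ n ∈ hφ.toFinset,
      (starRingEnd ℂ) (φ n) * ((tentCube R n : ℂ) * u n)) atTop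
      (𝓝 (∑ n ∈ hφ.toFinset, (starRingEnd ℂ) (φ n) * u n)) := by
    refine tendsto_finsetSum _ fun n _ => ?_
    have := (Complex.continuous_ofReal.tendsto 1).comp (tendsto_tentCube n)
    simpa using (this.mul_const (u n)).const_mul ((starRingEnd ℂ) (φ n))
  refine h1.congr' ?_
  filter_upwards [eventually_gt_atTop 0] with R hR
  rw [lp.inner_eq_tsum, tsum_eq_sum (s := hφ.toFinset) fun n hn => by rw [hz n hn]; simp]
  refine Finset.sum_congr rfl fun n _ => ?_
  rw [tentCut_apply u hR, RCLike.inner_apply, mul_comm]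

/-! ### Summability and tails under cubic decay. -/

theorem summable_norm_mul_abs_of_cubic_decay {w : ℤ → ℂ} {C : ℝ}
    (hw : ∀ k : ℤ, k ≠ 0 → ‖w k‖ < C / |(k : ℝ)| ^ 3) :
    Summable fun k : ℤ => ‖w k‖ * |(k : ℝ)| := by
  have h1 : Summable fun k : ℤ => C * (1 / (k : ℝ) ^ 2) :=
    (Real.summable_one_div_int_pow.mpr one_lt_two).mul_left C
  refine h1.of_nonneg_of_le (fun k => by positivity) fun k => ?_
  rcases eq_or_ne k 0 with rfl | hk
  · simp
  · have hk' : 0 < |(k : ℝ)| := by positivity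
    calc ‖w k‖ * |(k : ℝ)| ≤ C / |(k : ℝ)| ^ 3 * |(k : ℝ)| := by
          gcongr; exact (hw k hk).le
      _ = C * (1 / (k : ℝ) ^ 2) := by
          rw [← sq_abs (k : ℝ)]; field_simp

/-- Guarantees that the `tsum` in `longRange` is a genuine sum rather than the default value `0`, so
that the eigenvalue equation can be manipulated termwise. -/
theorem summable_mul_of_linear_growth {w u : ℤ → ℂ} {C K : ℝ}
    (hw : ∀ k : ℤ, k ≠ 0 → ‖w k‖ < C / |(k : ℝ)| ^ 3)
    (hu : ∀ m : ℤ, ‖u m‖ ≤ K * (1 + |(m : ℝ)|)) (n : ℤ) :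
    Summable fun k : ℤ => w k * u (n + k) := by
  have h1 := ((summable_of_cubic_decay hw).mul_left (K * (1 + |(n : ℝ)|))).add
    ((summable_norm_mul_abs_of_cubic_decay hw).mul_left K)
  have hK : 0 ≤ K := by simpa using (norm_nonneg _).trans (hu 0)
  refine h1.of_norm_bounded fun k => ?_
  rw [norm_mul]
  have h2 : |((n + k : ℤ) : ℝ)| ≤ |(n : ℝ)| + |(k : ℝ)| := by
    push_cast; exact abs_add_le _ _
  calc ‖w k‖ * ‖u (n + k)‖ ≤ ‖w k‖ * (K * (1 + (|(n : ℝ)| + |(k : ℝ)|))) := by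
        gcongr
        exact (hu _).trans (by gcongr)
    _ = _ := by ring

/-- The tail `|m| > R` of `‖u_m‖ / |m| ^ 3`. -/
def cubicTail (u : ℤ → ℂ) (R : ℕ) (m : ℤ) : ℝ :=
  if (R : ℝ) < |(m : ℝ)| then ‖u m‖ / |(m : ℝ)| ^ 3 else 0

theorem cubicTail_nonneg (u : ℤ → ℂ) (R : ℕ) (m : ℤ) : 0 ≤ cubicTail u R m := by
  unfold cubicTail; positivity

/-- Weighted arithmetic-geometric mean with parameter `t = R ^ (3 / 2)`, the largest for which `t² ≤
|m| ^ 3` on the whole tail `|m| > R`. The resulting bound, apart from the prefactor, is summable in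
`m` and independent of `R`. -/
theorem cubicTail_le {s : ℝ} (hs0 : 0 ≤ s) (hs1 : s < 1) (u : ℤ → ℂ) {R : ℕ} (hR : 0 < R)
    (m : ℤ) :
    cubicTail u R m ≤ (R * √R)⁻¹ *
      (4 * |(m : ℝ)| ^ (-(3 - 2 * s)) + ‖u m‖ ^ 2 / (1 + |(m : ℝ)|) ^ (2 * s)) := by
  have hR' : (1 : ℝ) ≤ R := by exact_mod_cast hR
  unfold cubicTail
  split_ifs with h
  · set y := |(m : ℝ)|
    set x := ‖u m‖
    set t : ℝ := R * √R
    have ht : 0 < t := by positivity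
    have htt : t * t = (R : ℝ) ^ 3 := by
      simp only [t]
      rw [mul_mul_mul_comm, Real.mul_self_sqrt (by positivity)]; ring
    have hy : 1 < y := by linarith
    have hy0 : 0 < y := by linarith
    set P := (1 + y) ^ (2 * s)
    have hP : 0 < P := by positivity
    have hP4 : P ≤ 4 * y ^ (2 * s) := by
      calc P ≤ (2 * y) ^ (2 * s) := Real.rpow_le_rpow (by positivity) (by linarith) (by linarith)
        _ = 2 ^ (2 * s) * y ^ (2 * s) := Real.mul_rpow (by norm_num) hy0.le
        _ ≤ 2 ^ (2 : ℝ) * y ^ (2 * s) := by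
          gcongr
          · norm_num
          · linarith
        _ = _ := by norm_num
    have h1 : x / y ^ 3 ≤ t * P / y ^ 6 + t⁻¹ * (x ^ 2 / P) := by
      have e : t * P / y ^ 6 + t⁻¹ * (x ^ 2 / P) - x / y ^ 3
          = ((t * P / y ^ 3 - x / 2) ^ 2 + 3 / 4 * x ^ 2) / (t * P) := by
        field_simp; ring
      have : 0 ≤ ((t * P / y ^ 3 - x / 2) ^ 2 + 3 / 4 * x ^ 2) / (t * P) := by positivity
      linarith
    have h2 : t * P / y ^ 6 ≤ t⁻¹ * (4 * y ^ (-(3 - 2 * s))) := by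
      have e : y ^ (-(3 - 2 * s)) = y ^ (2 * s) / y ^ 3 := by
        rw [← Real.rpow_natCast y 3, ← Real.rpow_sub hy0]; congr 1; push_cast; ring
      rw [e, inv_mul_eq_div, div_le_div_iff₀ (by positivity) ht]
      have h3 : (R : ℝ) ^ 3 ≤ y ^ 3 := by gcongr
      calc t * P * t = (R : ℝ) ^ 3 * P := by rw [← htt]; ring
        _ ≤ y ^ 3 * (4 * y ^ (2 * s)) := by gcongr
        _ = _ := by field_simp
    linarith
  · positivity

theorem exists_tsum_cubicTail_le {s : ℝ} (hs0 : 0 ≤ s) (hs1 : s < 1) {u : ℤ → ℂ}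
    (hu : Summable fun n : ℤ => ‖u n‖ ^ 2 / (1 + |(n : ℝ)|) ^ (2 * s)) :
    ∃ A : ℝ, 0 ≤ A ∧ ∀ R : ℕ, 0 < R →
      Summable (cubicTail u R) ∧ ∑' m, cubicTail u R m ≤ (R * √R)⁻¹ * A := by
  -- Here `s < 1` is decisive: it gives `3 - 2 * s > 1`.
  have h1 := ((Real.summable_abs_int_rpow (b := 3 - 2 * s) (by linarith)).mul_left 4).add hu
  refine ⟨∑' m : ℤ, (4 * |(m : ℝ)| ^ (-(3 - 2 * s)) + ‖u m‖ ^ 2 / (1 + |(m : ℝ)|) ^ (2 * s)),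
    tsum_nonneg fun m => by positivity, fun R hR => ?_⟩
  have h2 := h1.mul_left ((R : ℝ) * √R)⁻¹
  have h3 := h2.of_nonneg_of_le (cubicTail_nonneg u R) (cubicTail_le hs0 hs1 u hR)
  refine ⟨h3, ?_⟩
  rw [← tsum_mul_left]
  exact h3.tsum_le_tsum (cubicTail_le hs0 hs1 u hR) h2

/-! ### The commutator of the operator with the cutoff. -/

section Commutator

variable {w : ℤ → ℂ} {v : ℤ → ℝ} {C E : ℝ} {u : ℤ → ℂ}

/-- If `|n + k| ≤ R`, the cutoff is Lipschitz with constant `3 / R`. If `|n + k| > R`, it vanishes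
at `n + k`, and `tentCube_mul_le` turns decay in `k` into decay in `n + k`; the factor `truncate 1 R
n` records that `|n| ≤ R` in that case. -/
theorem norm_commutator_term_le (hw : ∀ k : ℤ, k ≠ 0 → ‖w k‖ < C / |(k : ℝ)| ^ 3) {R : ℕ}
    (hR : 0 < R) (n k : ℤ) :
    ‖w k * (((tentCube R (n + k) - tentCube R n : ℝ) : ℂ) * u (n + k))‖ ≤
      3 / R * (‖w k‖ * |(k : ℝ)| * ‖truncate u R (n + k)‖)
        + C * ‖truncate 1 R n‖ * cubicTail u R (n + k) := by
  have hC : 0 ≤ C := by simpa using (norm_nonneg _).trans (hw 1 one_ne_zero).le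
  rw [norm_mul, norm_mul, Complex.norm_real, Real.norm_eq_abs, truncate_apply, truncate_apply]
  unfold cubicTail
  rcases le_or_gt |((n + k : ℤ) : ℝ)| R with h | h
  · rw [if_pos h, if_neg h.not_gt, mul_zero, add_zero]
    have h1 := abs_tentCube_sub_le R (n + k) n
    push_cast at h1
    rw [add_sub_cancel_left] at h1
    calc _ ≤ ‖w k‖ * (3 / R * |(k : ℝ)| * ‖u (n + k)‖) := by gcongr
      _ = _ := by ring
  · rw [if_neg h.not_ge, if_pos h, tentCube_eq_zero hR h.le, norm_zero, mul_zero, mul_zero,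
      zero_add, zero_sub, abs_neg, abs_of_nonneg (tentCube_nonneg R n)]
    rcases le_or_gt |(n : ℝ)| R with hn | hn
    · rw [if_pos hn, Pi.one_apply, norm_one, mul_one]
      have hk : k ≠ 0 := by
        rintro rfl
        rw [add_zero] at h
        exact h.not_ge hn
      have h1 := tentCube_mul_le hR hn h
      push_cast at h1 ⊢
      rw [add_sub_cancel_left] at h1
      calc ‖w k‖ * (tentCube R n * ‖u (n + k)‖)
          ≤ C / |(k : ℝ)| ^ 3 * (tentCube R n * ‖u (n + k)‖) := by
            have := tentCube_nonneg R n
            gcongr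
            exact (hw k hk).le
        _ = C * (tentCube R n * (1 / |(k : ℝ)| ^ 3)) * ‖u (n + k)‖ := by ring
        _ ≤ C * (1 / |(n : ℝ) + k| ^ 3) * ‖u (n + k)‖ := by gcongr
        _ = _ := by ring
    · rw [tentCube_eq_zero hR hn.le]
      simp only [zero_mul, mul_zero]
      positivity

/-- Subtracting `tentCube R n` times the eigenvalue equation at `n` cancels both the potential and
`E`. -/
theorem longRangeOp_tentCut_sub_apply
    (hw : ∀ k : ℤ, k ≠ 0 → ‖w k‖ < C / |(k : ℝ)| ^ 3)
    (hv : BddAbove (Set.range fun n : ℤ => |v n|))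
    (hu : ∀ n : ℤ, longRange w v u n = (E : ℂ) * u n)
    (hsum : ∀ n : ℤ, Summable fun k : ℤ => w k * u (n + k)) {R : ℕ} (hR : 0 < R) (n : ℤ) :
    (longRangeOp w v (summable_of_cubic_decay hw) hv (tentCut u R)
        - (E : ℂ) • tentCut u R : EllTwo) n
      = ∑' k : ℤ, w k * (((tentCube R (n + k) - tentCube R n : ℝ) : ℂ) * u (n + k)) := by
  have hs1 := EllTwo.summable_mul_apply (summable_of_cubic_decay hw) (tentCut u R) n
  have hs2 := (hsum n).mul_left (tentCube R n : ℂ)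
  rw [lp.coeFn_sub, Pi.sub_apply, lp.coeFn_smul, Pi.smul_apply, longRangeOp_apply, smul_eq_mul,
    tentCut_apply u hR n]
  have hun := hu n
  rw [longRange] at hun
  have e : ∀ k : ℤ, w k * (((tentCube R (n + k) - tentCube R n : ℝ) : ℂ) * u (n + k))
      = w k * tentCut u R (n + k) - tentCube R n * (w k * u (n + k)) := fun k => by
    rw [tentCut_apply u hR]; push_cast; ring
  rw [tsum_congr e, hs1.tsum_sub hs2, tsum_mul_left]
  linear_combination ((tentCube R n : ℂ)) * hun

theorem exists_norm_commutator_le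
    (hw : ∀ k : ℤ, k ≠ 0 → ‖w k‖ < C / |(k : ℝ)| ^ 3)
    (hv : BddAbove (Set.range fun n : ℤ => |v n|))
    (hu : ∀ n : ℤ, longRange w v u n = (E : ℂ) * u n)
    (hsum : ∀ n : ℤ, Summable fun k : ℤ => w k * u (n + k)) {s : ℝ} (hs0 : 0 ≤ s) (hs1 : s < 1)
    (hus : Summable fun n : ℤ => ‖u n‖ ^ 2 / (1 + |(n : ℝ)|) ^ (2 * s)) :
    ∃ A : ℝ, 0 ≤ A ∧ ∀ R : ℕ, 0 < R →
      ‖longRangeOp w v (summable_of_cubic_decay hw) hv (tentCut u R) - (E : ℂ) • tentCut u R‖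
        ≤ A / R * (‖truncate u R‖ + 1) := by
  have hC : 0 ≤ C := by simpa using (norm_nonneg _).trans (hw 1 one_ne_zero).le
  obtain ⟨A, hA, hA'⟩ := exists_tsum_cubicTail_le hs0 hs1 hus
  set W : ℤ → ℂ := fun k => ((‖w k‖ * |(k : ℝ)| : ℝ) : ℂ) with hW
  have hWn : ∀ k, ‖W k‖ = ‖w k‖ * |(k : ℝ)| := fun k => by
    rw [hW, Complex.norm_real, Real.norm_of_nonneg (by positivity)]
  have hWs : Summable fun k => ‖W k‖ :=
    (summable_norm_mul_abs_of_cubic_decay hw).congr fun k => (hWn k).symm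
  set S := ∑' k, ‖W k‖
  have hS : 0 ≤ S := tsum_nonneg fun k => norm_nonneg _
  refine ⟨3 * S + 2 * C * A, by positivity, fun R hR => ?_⟩
  have hR' : (1 : ℝ) ≤ R := by exact_mod_cast hR
  obtain ⟨B, hB, hBle⟩ : ∃ B, HasSum (cubicTail u R) B ∧ B ≤ (R * √R)⁻¹ * A :=
    ⟨_, (hA' R hR).1.hasSum, (hA' R hR).2⟩
  have hB0 : 0 ≤ B := hB.nonneg (cubicTail_nonneg u R)
  set V := truncate (fun n => (‖u n‖ : ℂ)) R
  have hV : ∀ n, V n = (‖truncate u R n‖ : ℂ) := fun n => by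
    simp only [V, truncate_apply]
    split_ifs <;> simp
  have hVn : ‖V‖ = ‖truncate u R‖ := by
    rw [← sq_eq_sq₀ (norm_nonneg _) (norm_nonneg _), norm_truncate_sq, norm_truncate_sq]
    simp
  -- `X` is the correlation of `|k| ‖w k‖` with the truncated `‖u‖`; as a norm-convergent sum of
  -- shifts it obeys Young's inequality with the constant `S`.
  set X : EllTwo := ∑' k, W k • EllTwo.shiftBy k V
  have hX0 : ∀ n, HasSum (fun k => ‖w k‖ * |(k : ℝ)| * ‖truncate u R (n + k)‖) ‖X n‖ ∧
      X n = (‖X n‖ : ℂ) := fun n => by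
    have h1 := EllTwo.hasSum_mul_shiftBy hWs V n
    have h2 : HasSum (fun k => ((‖w k‖ * |(k : ℝ)| * ‖truncate u R (n + k)‖ : ℝ) : ℂ)) (X n) := by
      refine h1.congr_fun fun k => ?_
      rw [hV, hW]; push_cast; rfl
    have h3 : Summable fun k => ‖w k‖ * |(k : ℝ)| * ‖truncate u R (n + k)‖ :=
      Complex.summable_ofReal.mp h2.summable
    have h4 := h2.unique (Complex.hasSum_ofReal.mpr h3.hasSum)
    have h5 : ‖X n‖ = ∑' k, ‖w k‖ * |(k : ℝ)| * ‖truncate u R (n + k)‖ := by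
      rw [h4, Complex.norm_real, Real.norm_of_nonneg (tsum_nonneg fun k => by positivity)]
    rw [h5]
    exact ⟨h3.hasSum, h4⟩
  have hXn : ‖X‖ ≤ S * ‖truncate u R‖ := by
    refine (norm_tsum_le_tsum_norm (EllTwo.summable_smul_shiftBy hWs V)).trans (le_of_eq ?_)
    rw [← tsum_mul_right]
    exact tsum_congr fun k => by rw [norm_smul, EllTwo.norm_shiftBy, hVn]
  set g : EllTwo :=
    longRangeOp w v (summable_of_cubic_decay hw) hv (tentCut u R) - (E : ℂ) • tentCut u R
  have hg : ∀ n, ‖g n‖ ≤ 3 / R * ‖X n‖ + C * ‖truncate 1 R n‖ * B := fun n => by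
    have hBn : HasSum (fun k => cubicTail u R (n + k)) B :=
      ((Equiv.addLeft n).hasSum_iff (f := cubicTail u R)).mpr hB
    have h1 := ((hX0 n).1.mul_left (3 / (R : ℝ))).add (hBn.mul_left (C * ‖truncate 1 R n‖))
    have h2 := tsum_of_norm_bounded h1 (norm_commutator_term_le hw hR n)
    rwa [← longRangeOp_tentCut_sub_apply hw hv hu hsum hR n] at h2
  set G : EllTwo := ((3 / R : ℝ) : ℂ) • X + ((C * B : ℝ) : ℂ) • truncate 1 R with hG
  have hgG : ∀ n, ‖g n‖ ≤ ‖G n‖ := fun n => by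
    have h1 : truncate 1 R n = (‖truncate 1 R n‖ : ℂ) := by
      rw [truncate_apply]
      split_ifs <;> simp
    have h2 : G n = ((3 / R * ‖X n‖ + C * ‖truncate 1 R n‖ * B : ℝ) : ℂ) := by
      rw [hG, lp.coeFn_add, Pi.add_apply, lp.coeFn_smul, lp.coeFn_smul, Pi.smul_apply,
        Pi.smul_apply, smul_eq_mul, smul_eq_mul, (hX0 n).2, h1]
      push_cast
      simp only [Complex.norm_real, norm_norm]
      ring
    rw [h2, Complex.norm_real]
    exact (hg n).trans (le_abs_self _)
  -- This factor `√R` reduces the tail bound `R ^ (-3 / 2)` to the required `1 / R`.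
  have h1R : ‖truncate 1 R‖ ≤ 2 * √R := by
    refine (sq_le_sq₀ (norm_nonneg _) (by positivity)).mp ?_
    rw [norm_truncate_one, mul_pow, Real.sq_sqrt (by positivity)]
    linarith
  calc ‖g‖ ≤ ‖G‖ := lp.norm_mono (by norm_num) hgG
    _ ≤ 3 / R * ‖X‖ + C * B * ‖truncate 1 R‖ := by
        refine (norm_add_le _ _).trans (le_of_eq ?_)
        rw [norm_smul, norm_smul, Complex.norm_real, Complex.norm_real,
          Real.norm_of_nonneg (by positivity), Real.norm_of_nonneg (by positivity)]
    _ ≤ 3 / R * (S * ‖truncate u R‖) + C * ((R * √R)⁻¹ * A) * (2 * √R) := by gcongr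
    _ = 3 * S / R * ‖truncate u R‖ + 2 * C * A / R := by field_simp
    -- Nonnegative cross terms are added so that the sum factors.
    _ ≤ 3 * S / R * ‖truncate u R‖ + 2 * C * A / R
          + (3 * S / R + 2 * C * A / R * ‖truncate u R‖) := by
        have : 0 ≤ 3 * S / R + 2 * C * A / R * ‖truncate u R‖ := by positivity
        linarith
    _ = _ := by ring

end Commutator

/-! ### Growth of the eigenfunction against the Poisson integral. -/

theorem norm_sq_le_of_summable_weighted {u : ℤ → ℂ} {s : ℝ}
    (hu : Summable fun n : ℤ => ‖u n‖ ^ 2 / (1 + |(n : ℝ)|) ^ (2 * s)) (m : ℤ) :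
    ‖u m‖ ^ 2 ≤ (∑' n : ℤ, ‖u n‖ ^ 2 / (1 + |(n : ℝ)|) ^ (2 * s)) * (1 + |(m : ℝ)|) ^ (2 * s) := by
  rw [← div_le_iff₀ (by positivity)]
  exact hu.le_tsum m fun n _ => by positivity

theorem norm_le_linear_of_summable_weighted {u : ℤ → ℂ} {s : ℝ} (hs : s < 1)
    (hu : Summable fun n : ℤ => ‖u n‖ ^ 2 / (1 + |(n : ℝ)|) ^ (2 * s)) (m : ℤ) :
    ‖u m‖ ≤ √(∑' n : ℤ, ‖u n‖ ^ 2 / (1 + |(n : ℝ)|) ^ (2 * s)) * (1 + |(m : ℝ)|) := by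
  have h0 : 0 ≤ ∑' n : ℤ, ‖u n‖ ^ 2 / (1 + |(n : ℝ)|) ^ (2 * s) :=
    tsum_nonneg fun n => by positivity
  refine (sq_le_sq₀ (norm_nonneg _) (by positivity)).mp ?_
  rw [mul_pow, Real.sq_sqrt h0]
  refine (norm_sq_le_of_summable_weighted hu m).trans (mul_le_mul_of_nonneg_left ?_ h0)
  rw [← Real.rpow_natCast]
  refine Real.rpow_le_rpow_of_exponent_le (by linarith [abs_nonneg (m : ℝ)]) ?_
  push_cast
  linarith

theorem norm_truncate_sq_le_of_summable_weighted {u : ℤ → ℂ} {s : ℝ} (hs0 : 0 ≤ s)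
    (hu : Summable fun n : ℤ => ‖u n‖ ^ 2 / (1 + |(n : ℝ)|) ^ (2 * s)) (R : ℕ) :
    ‖truncate u R‖ ^ 2
      ≤ (∑' n : ℤ, ‖u n‖ ^ 2 / (1 + |(n : ℝ)|) ^ (2 * s)) * (1 + R) ^ (2 * s) := by
  rw [norm_truncate_sq, ← div_le_iff₀ (by positivity), Finset.sum_div]
  refine le_trans (Finset.sum_le_sum fun n hn => ?_)
    (hu.sum_le_tsum (Finset.Icc (-(R : ℤ)) R) fun n _ => by positivity)
  have : |(n : ℝ)| ≤ R := by
    rw [Finset.mem_Icc] at hn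
    rw [abs_le]
    exact_mod_cast hn
  gcongr

/-- A lower bound on the Poisson integrals of the spectral measure in terms of the growth of a
generalized eigenfunction. -/
theorem exists_le_poissonForm_mul_norm_truncate_sq
    {w : ℤ → ℂ} {v : ℤ → ℝ} (hsymm : ∀ k : ℤ, conj (w (-k)) = w k)
    (hv : BddAbove (Set.range fun n : ℤ => |v n|))
    {C : ℝ} (hw : ∀ k : ℤ, k ≠ 0 → ‖w k‖ < C / |(k : ℝ)| ^ 3)
    {E : ℝ} {u : ℤ → ℂ} (hu0 : u ≠ 0)
    (hu : ∀ n : ℤ, longRange w v u n = (E : ℂ) * u n)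
    {s : ℝ} (hs0 : 0 ≤ s) (hs : s < 1)
    (hus : Summable fun n : ℤ => ‖u n‖ ^ 2 / (1 + |(n : ℝ)|) ^ (2 * s))
    {φ : EllTwo} (hφ : (Function.support (φ : ℤ → ℂ)).Finite)
    (hφu : ∑' n : ℤ, (starRingEnd ℂ) (φ n) * u n ≠ 0) :
    ∃ c : ℝ, 0 < c ∧ ∀ᶠ R : ℕ in atTop, c ≤
      poissonForm (longRangeOp w v (summable_of_cubic_decay hw) hv) φ E (1 / R)
        * ‖truncate u R‖ ^ 2 := by
  have hsum := summable_mul_of_linear_growth hw (norm_le_linear_of_summable_weighted hs hus)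
  obtain ⟨A, hA, hA'⟩ := exists_norm_commutator_le hw hv hu hsum hs0 hs hus
  have hT := isSelfAdjoint_longRangeOp (summable_of_cubic_decay hw) hv hsymm
  set T := longRangeOp w v (summable_of_cubic_decay hw) hv
  obtain ⟨n₀, hn₀⟩ := Function.ne_iff.mp hu0
  set a := ‖u n₀‖
  have ha : 0 < a := norm_pos_iff.mpr hn₀
  set b := ‖∑' n : ℤ, (starRingEnd ℂ) (φ n) * u n‖
  have hb : 0 < b := norm_pos_iff.mpr hφu
  set D := 1 + A * (1 + 1 / a)
  have hD : 0 < D := by positivity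
  refine ⟨(b / 2 / D) ^ 2, by positivity, ?_⟩
  have hlim := (tendsto_inner_tentCut hφ u).norm
  filter_upwards [hlim.eventually_const_le (half_lt_self hb), eventually_gt_atTop 0,
    eventually_ge_atTop n₀.natAbs] with R h1 hR hRn
  have hR' : (0 : ℝ) < R := by exact_mod_cast hR
  have hF := poissonForm_nonneg T φ E (one_div_pos.mpr hR')
  have h2 := norm_inner_le_sqrt_poissonForm hT E (one_div_pos.mpr hR') φ (tentCut u R)
  set F := poissonForm T φ E (1 / R)
  set U := ‖truncate u R‖
  -- As `u ≠ 0`, the truncated norm is eventually at least `a > 0`; this absorbs the additive `1` of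
  -- the commutator bound into a multiple of `U`.
  have hU : a ≤ U := by
    refine le_trans (le_of_eq ?_) (lp.norm_apply_le_norm (by norm_num) (truncate u R) n₀)
    rw [truncate_apply, if_pos]
    rw [← Int.cast_abs, Int.abs_eq_natAbs]
    exact_mod_cast hRn
  have h3 : ‖tentCut u R‖ + ‖T (tentCut u R) - (E : ℂ) • tentCut u R‖ / (1 / R) ≤ D * U := by
    have h4 : ‖T (tentCut u R) - (E : ℂ) • tentCut u R‖ / (1 / R) ≤ A * (U + 1) := by
      rw [div_le_iff₀ (by positivity)]
      calc _ ≤ _ := hA' R hR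
        _ = _ := by ring
    have h5 : 1 ≤ 1 / a * U := by
      rw [div_mul_eq_mul_div, one_mul, le_div_iff₀ ha]; linarith
    calc _ ≤ U + A * (U + 1 / a * U) := by
          refine add_le_add (norm_tentCut_le u R) (h4.trans ?_)
          gcongr
      _ = D * U := by ring
  have h6 : b / 2 / D ≤ √F * U := by
    rw [div_le_iff₀ hD]
    calc b / 2 ≤ √F * (D * U) := h1.trans (h2.trans (by gcongr))
      _ = _ := by ring
  calc (b / 2 / D) ^ 2 ≤ (√F * U) ^ 2 := by gcongr
    _ = F * U ^ 2 := by rw [mul_pow, Real.sq_sqrt hF]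

/-- Polynomial growth along a subsequence, with an exponent below `2`. -/
theorem exists_frequently_norm_truncate_sq_le {u : ℤ → ℂ} {s α : ℝ} (hs0 : 0 ≤ s) (hs : s < 1)
    (hus : Summable fun n : ℤ => ‖u n‖ ^ 2 / (1 + |(n : ℝ)|) ^ (2 * s))
    (hgrowth : liminf (fun R : ℕ =>
      ENNReal.ofReal ((R : ℝ) ^ (-α) * ∑ n ∈ Finset.Icc (-(R : ℤ)) R, ‖u n‖ ^ 2)) atTop < ∞) :
    ∃ γ ≤ α, γ < 2 ∧ ∃ K : ℝ, 0 < K ∧ ∃ᶠ R : ℕ in atTop, ‖truncate u R‖ ^ 2 ≤ K * (R : ℝ) ^ γ := by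
  rcases lt_or_ge α 2 with hα | hα
  · obtain ⟨K, hK1, hK2⟩ := ENNReal.lt_iff_exists_nnreal_btwn.mp hgrowth
    refine ⟨α, le_rfl, hα, K + 1, by positivity, ?_⟩
    refine ((frequently_lt_of_liminf_lt (by isBoundedDefault) hK1).and_eventually
      (eventually_gt_atTop 0)).mono fun R hR => ?_
    obtain ⟨h1, h2⟩ := hR
    have hR' : (0 : ℝ) < R := by exact_mod_cast h2
    rw [← ENNReal.ofReal_coe_nnreal, ← norm_truncate_sq, Real.rpow_neg hR'.le, inv_mul_eq_div]
      at h1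
    have h3 := (ENNReal.ofReal_lt_ofReal_iff_of_nonneg (by positivity)).mp h1
    rw [div_lt_iff₀ (by positivity)] at h3
    have : 0 < (R : ℝ) ^ α := by positivity
    linarith
  -- For `α ≥ 2` the Poisson argument is unavailable, but weighted summability alone gives growth
  -- with the exponent `2 * s < 2 ≤ α`, at every scale.
  · refine ⟨2 * s, by linarith, by linarith, ((∑' n : ℤ, ‖u n‖ ^ 2 / (1 + |(n : ℝ)|) ^ (2 * s)) + 1)
      * 2 ^ (2 * s), ?_, Eventually.frequently ?_⟩
    · have : 0 ≤ ∑' n : ℤ, ‖u n‖ ^ 2 / (1 + |(n : ℝ)|) ^ (2 * s) :=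
        tsum_nonneg fun n => by positivity
      positivity
    · filter_upwards [eventually_ge_atTop 1] with R hR
      have hR' : (1 : ℝ) ≤ R := by exact_mod_cast hR
      have h0 : 0 ≤ ∑' n : ℤ, ‖u n‖ ^ 2 / (1 + |(n : ℝ)|) ^ (2 * s) :=
        tsum_nonneg fun n => by positivity
      refine (norm_truncate_sq_le_of_summable_weighted hs0 hus R).trans ?_
      rw [mul_assoc, ← Real.mul_rpow (by norm_num) (by positivity)]
      gcongr <;> linarith

end

/-! ### Conclusion. -/

theorem mainTheorem2
    (w : ℤ → ℂ) (v : ℤ → ℝ) (hsymm : ∀ k : ℤ, conj (w (-k)) = w k)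
    (hv : BddAbove (Set.range fun n : ℤ => |v n|))
    (C : ℝ) (hw : ∀ k : ℤ, k ≠ 0 → ‖w k‖ < C / |(k : ℝ)| ^ 3)
    (E α : ℝ) (u : ℤ → ℂ) (hu0 : u ≠ 0)
    (hu : ∀ n : ℤ, longRange w v u n = (E : ℂ) * u n)
    (s : ℝ) (hs : s < 1)
    (hus : Summable fun n : ℤ => ‖u n‖ ^ 2 / (1 + |(n : ℝ)|) ^ (2 * s))
    (hgrowth : liminf (fun R : ℕ =>
      ENNReal.ofReal ((R : ℝ) ^ (-α) * ∑ n ∈ Finset.Icc (-(R : ℤ)) R, ‖u n‖ ^ 2)) atTop < ∞)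
    (φ : EllTwo) (hφ : (Function.support (φ : ℤ → ℂ)).Finite)
    (hφu : ∑' n : ℤ, (starRingEnd ℂ) (φ n) * u n ≠ 0) :
    0 < upperDerivative
      (spectralMeasure (longRangeOp w v (summable_of_cubic_decay hw) hv)
        (isSelfAdjoint_longRangeOp (summable_of_cubic_decay hw) hv hsymm) φ) α E := by
  have hus' : Summable fun n : ℤ => ‖u n‖ ^ 2 / (1 + |(n : ℝ)|) ^ (2 * max s 0) := by
    refine hus.of_nonneg_of_le (fun n => by positivity) fun n => ?_
    have : (1 : ℝ) ≤ 1 + |(n : ℝ)| := by linarith [abs_nonneg (n : ℝ)]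
    gcongr
    exact le_max_left _ _
  have hs' : max s 0 < 1 := max_lt hs one_pos
  have hs0 : 0 ≤ max s 0 := le_max_right _ _
  obtain ⟨c, hc, hc'⟩ := exists_le_poissonForm_mul_norm_truncate_sq hsymm hv hw hu0 hu hs0 hs'
    hus' hφ hφu
  obtain ⟨γ, hγα, hγ2, K, hK, hfreq⟩ := exists_frequently_norm_truncate_sq_le hs0 hs' hus' hgrowth
  have hT := isSelfAdjoint_longRangeOp (summable_of_cubic_decay hw) hv hsymm
  obtain ⟨S, hS, hle⟩ := exists_finite_re_inner_cfc_le hT φ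
  rw [pos_iff_ne_zero]
  intro hzero
  -- With this `δ` the upper bound for the product of the Poisson integral and `‖truncate u R‖ ^ 2`
  -- is `c / 2`, below the lower bound `c`.
  have hδ : 0 < c / (2 * K) := by positivity
  have hsmall := lintegral_poissonWeight_isLittleO
    (ν := (spectralMeasure (longRangeOp w v (summable_of_cubic_decay hw) hv) hT φ).restrict S)
    (E := E) hγ2 (fun δ hδ => (eventually_measure_le_of_upperDerivative_eq_zero hzero hγα hδ).mono
      fun ε h => (Measure.restrict_apply_le _ _).trans h) hδ
  have hlim : Tendsto (fun R : ℕ => 1 / (R : ℝ)) atTop (𝓝[>] 0) := by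
    refine tendsto_nhdsWithin_iff.mpr ⟨tendsto_one_div_atTop_nhds_zero_nat, ?_⟩
    filter_upwards [eventually_gt_atTop 0] with R hR
    have : (0 : ℝ) < R := by exact_mod_cast hR
    exact one_div_pos.mpr this
  -- The growth bound holds only along a subsequence, but the other two bounds hold for all large
  -- `R`, so one common scale exists.
  obtain ⟨R, hR1, ⟨hR2, hR3⟩, hR4⟩ := (hfreq.and_eventually
    ((hc'.and (hlim.eventually hsmall)).and (eventually_gt_atTop 0))).exists
  have hR : (0 : ℝ) < R := by exact_mod_cast hR4
  have h1 := (hle _ (continuous_poissonWeight E (one_div_pos.mpr hR))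
    (poissonWeight_nonneg E _)).trans hR3
  have hnn : 0 ≤ c / (2 * K) * (1 / (R : ℝ)) ^ γ := by positivity
  rw [ENNReal.ofReal_le_ofReal_iff hnn, Real.div_rpow one_pos.le hR.le, Real.one_rpow] at h1
  have hRγ : 0 < (R : ℝ) ^ γ := by positivity
  have h2 : c ≤ c / (2 * K) * (1 / (R : ℝ) ^ γ) * (K * (R : ℝ) ^ γ) :=
    hR2.trans (mul_le_mul h1 hR1 (by positivity) (by positivity))
  rw [show c / (2 * K) * (1 / (R : ℝ) ^ γ) * (K * (R : ℝ) ^ γ) = c / 2 by field_simp] at h2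
  linarith
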